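/- Let $G$ be a (finite-dimensional, real, smooth) Lie group with Lie algebra $\mathfrak g=T_eG$, and let $n\ge 1$. Fix $g_0\in G$. A control sequence $\mathbf u=(u_0,\dots,u_{n-1})\in G^n$ determines states $g_0,\dots,g_n$ by $g_{i+1}=g_iu_i$, and the cost $$J(\mathbf u)=\ell(g_n)+\sum_{i=0}^{n-1}L_i(g_i,u_i),$$ where $\ell:G\to\mathbb R$ is locally Lipschitz and each $L_i:G\times G\to\mathbb R$ is $C^1$. Definitions. For a function $f:M\to\mathbb R\cup\{\infty\}$ on a manifold $M$, a covector $p\in T_q^*M$ is a Fréchet subgradient of $f$ at $q$ if $p=d\phi(q)$ for some $C^1$ function $\phi:M\to\mathbb R$ such that $f-\phi$ has a local minimum at $q$. The limiting subdifferential $\partial_Lf(q)$ is the set of limits $p=\lim p_k$ (in $T^*M$) of Fréchet subgradients $p_k$ of $f$ at points $q_k\to q$ with $f(q_k)\to f(q)$. For closed $S\subset M$ and $q\in S$, the Clarke tangent cone $T^C_S(q)$ is the set of $v\in T_qM$ with $\langle p,v\rangle\le 0$ for all $p\in\partial_L\chi_S(q)$, where $\chi_S=0$ on $S$ and $\chi_S=\infty$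 off $S$. The control $\mathbf u$ is critical for $J$ if for every $\mathbf v\in T^C_{G^n}(\mathbf u)$ (controls are unconstrained, so $S=M=G^n$) the lower Dini derivative $$\underline DJ(\mathbf u;\mathbf v)=\liminf_{\lambda\downarrow0}\frac{J(c(\lambda))-J(\mathbf u)}{\lambda}$$ is nonnegative, where $c:\mathbb R\to G^n$ is any smooth curve with $c(0)=\mathbf u$, $c'(0)=\mathbf v$ (the value does not depend on $c$, as $J$ is locally Lipschitz). Covectors at $g\in G$ are identified with elements of $\mathfrak g^*$ by left translation: $\xi\in T_g^*G$ corresponds to $a\mapsto\langle\xi,D\mathsf L_g(e)a\rangle$, where $\mathsf L_g(h)=gh$; $d_gL_i$ and $d_uL_i$ denote the partial differentials of $L_i(g,u)$, seen in $\mathfrak g^*$ this way. For $u\in G$, $\mathrm{Ad}_u:\mathfrak g\to\mathfrak g$ is the derivative at $e$ of $h\mapsto uhu^{-1}$, and $\mathrm{Ad}_u^*:=(\mathrm{Ad}_u)^*:\mathfrak g^*\to\mathfrak g^*$ is its dual map, $\langle\mathrm{Ad}_u^*p,a\rangle=\langle p,\mathrm{Ad}_ua\rangle$. Theorem. If $\mathbf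 u$ is critical for $J$, then the sequence $p_i\in\mathfrak g^*$ defined by $$p_i=d_uL_{i-1}(g_{i-1},u_{i-1})\qquad(1\le i\le n)$$ evolves according to $$p_{i+1}=\mathrm{Ad}_{u_i}^*(p_i)+\mathrm{Ad}_{u_i}^*\bigl(d_gL_i(g_i,u_i)\bigr)\qquad(1\le i\le n-1)$$ and satisfies the endpoint condition $-p_n\in\partial_L\ell(g_n)$ (under the identification $T_{g_n}^*G\cong\mathfrak g^*$ above). -/

import Mathlib

open Set Filter Topology Bundle
open scoped Manifold ContDiff

noncomputable section

section ProductManifold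

/-- A finite product of `C^m` manifolds is a `C^m` manifold. -/
instance instIsManifoldPi {ι : Type*} [Fintype ι]
    {E : ι → Type*} [∀ i, NormedAddCommGroup (E i)] [∀ i, NormedSpace ℝ (E i)]
    {H : ι → Type*} [∀ i, TopologicalSpace (H i)] (I : ∀ i, ModelWithCorners ℝ (E i) (H i))
    {M : ι → Type*} [∀ i, TopologicalSpace (M i)] [∀ i, ChartedSpace (H i) (M i)]
    (m : ℕ∞ω) [hM : ∀ i, IsManifold (I i) m (M i)] :
    IsManifold (ModelWithCorners.pi I) m (∀ i, M i) := by
  refine isManifold_of_contDiffOn _ _ _ ?_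
  rintro e e' ⟨f, hf, rfl⟩ ⟨f', hf', rfl⟩
  rw [contDiffOn_pi]
  intro i
  have h := ((contDiffGroupoid m (I i)).compatible (hf i (mem_univ i)) (hf' i (mem_univ i)))
  have h2 := (contDiffGroupoid m (I i)).mem_of_eqOnSource h (Setoid.refl _)
  rw [contDiffGroupoid, mem_groupoid_of_pregroupoid] at h2
  have h3 : ContDiffOn ℝ m (I i ∘ ((f i).symm ≫ₕ f' i) ∘ (I i).symm)
    ((I i).symm ⁻¹' ((f i).symm ≫ₕ f' i).source ∩ range (I i)) := h2.1
  have h4 : ContDiff ℝ m (fun x : (∀ j, E j) => x i) :=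
    (ContinuousLinearMap.proj (R := ℝ) (φ := E) i).contDiff
  refine h3.comp h4.contDiffOn ?_
  rintro x ⟨hx, y, rfl⟩
  refine ⟨?_, y i, rfl⟩
  exact ⟨hx.1 i (mem_univ i), hx.2 i (mem_univ i)⟩

end ProductManifold

section Nonsmooth

variable {E : Type*} [NormedAddCommGroup E] [NormedSpace ℝ E]
  {H : Type*} [TopologicalSpace H] (I : ModelWithCorners ℝ E H)
  {M : Type*} [TopologicalSpace M] [ChartedSpace H M]

/-- The space of covectors `T_q^* M`. -/
abbrev Covector (q : M) : Type _ := TangentSpace I q →L[ℝ] (Bundle.Trivial M ℝ) q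

variable (M) in
/-- The cotangent bundle `T^* M`, with its usual topology: it is the bundle of continuous linear
maps from the tangent bundle to the trivial line bundle. -/
abbrev CotangentBundle : Type _ :=
  TotalSpace (E →L[ℝ] ℝ) (fun q : M => Covector I q)

/-- `f : M → ℝ` is locally Lipschitz: around every point there is a smooth chart in which `f` is
Lipschitz. -/
def LocallyLipschitzMfd (f : M → ℝ) : Prop :=
  ∀ q : M, ∃ φ ∈ IsManifold.maximalAtlas I ∞ M, q ∈ φ.source ∧
    ∃ K : NNReal, LipschitzOnWith K (f ∘ (φ.extend I).symm) (φ.extend I '' φ.source)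

/-- The lower Dini derivative `liminf_{λ ↓ 0} (f (c_v λ) - f q) / λ`, where `c_v : ℝ → M` is any
smooth curve through `q` with velocity `v`. For locally Lipschitz `f` the liminf does not depend
on the curve; the infimum over all these curves serves to make the definition choice free. -/
def lowerDini (f : M → ℝ) (q : M) (v : TangentSpace I q) : EReal :=
  ⨅ c ∈ {c : ℝ → M | ContMDiff 𝓘(ℝ, ℝ) I ∞ c ∧
      (⟨c 0, mfderiv 𝓘(ℝ, ℝ) I c 0 (1 : ℝ)⟩ : TangentBundle I M) = ⟨q, v⟩},
    liminf (fun t : ℝ => (((f (c t) - f q) / t : ℝ) : EReal)) (𝓝[>] 0)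

/-- The Fréchet subdifferential of `f : M → ℝ ∪ {∞}` at `q`: the covectors `dg(q)`, where
`g : M → ℝ` is `C^1` and `f - g` has a local minimum at `q`. -/
def frechetSubdiff (f : M → EReal) (q : M) : Set (Covector I q) :=
  {p | ∃ g : M → ℝ, ContMDiff I 𝓘(ℝ, ℝ) 1 g ∧ p = mfderiv I 𝓘(ℝ, ℝ) g q ∧
    IsLocalMin (fun x => f x - (g x : EReal)) q}

/-- The limiting subdifferential of `f : M → ℝ ∪ {∞}` at `q`: the limits in `T^* M` of Fréchet
subgradients `p_k` at points `q_k → q` with `f (q_k) → f q`. -/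
def limitingSubdiff [IsManifold I 1 M] (f : M → EReal) (q : M) : Set (Covector I q) :=
  {p | ∃ P : ℕ → CotangentBundle I M,
    (∀ k, (P k).2 ∈ frechetSubdiff I f (P k).1) ∧
    Tendsto (fun k => f (P k).1) atTop (𝓝 (f q)) ∧
    Tendsto P atTop (𝓝 ⟨q, p⟩)}

open scoped Classical in
/-- The function `χ_S`, equal to `0` on `S` and to `∞` off `S`. -/
def chi (S : Set M) (q : M) : EReal := if q ∈ S then 0 else ⊤

/-- The limiting normal cone to `S` at `q`. -/
def limitingNormalCone [IsManifold I 1 M] (S : Set M) (q : M) : Set (Covector I q) :=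
  limitingSubdiff I (chi S) q

/-- The Clarke tangent cone to `S` at `q`: the polar of the limiting normal cone. -/
def clarkeTangentCone [IsManifold I 1 M] (S : Set M) (q : M) : Set (TangentSpace I q) :=
  {v | ∀ p ∈ limitingNormalCone I S q, (p v : ℝ) ≤ 0}

/-- `u` is critical for `J` relative to the set `S`: the lower Dini derivative of `J` at `u` is
nonnegative in every direction of the Clarke tangent cone to `S` at `u`. -/
def IsCritical [IsManifold I 1 M] (S : Set M) (J : M → ℝ) (u : M) : Prop :=
  u ∈ S ∧ ∀ v ∈ clarkeTangentCone I S u, 0 ≤ lowerDini I J u v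

end Nonsmooth

section ControlSystem

variable {Q U : Type*} {n : ℕ}

/-- The state sequence `q_{i+1} = F_i(q_i, u_i)` with initial state `q₀`. -/
def stateSeq (F : Fin n → Q → U → Q) (q₀ : Q) (u : Fin n → U) : Fin (n + 1) → Q :=
  Fin.induction q₀ (fun i q => F i q (u i))

/-- The cost `J(u) = ℓ(q_n) + ∑_{i < n} L_i(q_i, u_i)`, for fixed initial state `q₀`. -/
def totalCost (F : Fin n → Q → U → Q) (ℓ : Q → ℝ) (L : Fin n → Q × U → ℝ) (q₀ : Q)
    (u : Fin n → U) : ℝ :=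
  ℓ (stateSeq F q₀ u (Fin.last n)) + ∑ i : Fin n, L i (stateSeq F q₀ u i.castSucc, u i)

end ControlSystem

section LieGroup

variable {E : Type*} [NormedAddCommGroup E] [NormedSpace ℝ E]
  {H : Type*} [TopologicalSpace H] (I : ModelWithCorners ℝ E H)
  {G : Type*} [TopologicalSpace G] [ChartedSpace H G] [Group G]

variable (G) in
/-- The dual `𝔤^*` of the Lie algebra `𝔤 = T_1 G`. -/
abbrev LieDual : Type _ := GroupLieAlgebra I G →L[ℝ] ℝ

/-- The derivative at `1` of the left multiplication by `g`, as a map `𝔤 → T_g G`. -/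
def leftTriv (g : G) : GroupLieAlgebra I G →L[ℝ] TangentSpace I g :=
  mfderiv I I (fun h : G => g * h) 1

/-- The covector `ξ ∈ T_g^* G` seen as an element of `𝔤^*`, by left trivialization. -/
def toLieDual (g : G) (ξ : Covector I g) : LieDual I G := ξ.comp (leftTriv I g)

/-- The differential at `g` of `f : G → ℝ`, seen as an element of `𝔤^*`, by left
trivialization. -/
def leftDifferential (f : G → ℝ) (g : G) : LieDual I G :=
  toLieDual I g (mfderiv I 𝓘(ℝ, ℝ) f g)

/-- The adjoint representation: `Ad_g : 𝔤 → 𝔤` is the derivative at `1` of `h ↦ g h g⁻¹`. -/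
def lieAd (g : G) : GroupLieAlgebra I G →L[ℝ] GroupLieAlgebra I G :=
  mfderiv I I (fun h : G => g * h * g⁻¹) 1

/-- The dual map `(Ad_g)^* : 𝔤^* → 𝔤^*`, i.e. `⟨(Ad_g)^* p, a⟩ = ⟨p, Ad_g a⟩`. -/
def lieAdDual (g : G) (p : LieDual I G) : LieDual I G := p.comp (lieAd I g)

end LieGroup

end

/-! Controls and states determine each other through `u i = (g i)⁻¹ * g (i+1)`, so the cost can be
read as a function `trajectoryCost` of the states. A single state enters at most two running terms,
and moving any state except the initial one is an admissible variation, because the Clarke tangent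
cone to the whole manifold is the whole tangent space.

At an interior state the moving part is `C^1`, so nonnegative Dini derivatives in opposite
directions force its differential to vanish. By left invariance the incoming term contributes `p i`;
by `lieAdDual_leftDifferential_pair` the outgoing one contributes, after `Ad^*`, the state
differential minus `p (i+1)`. This is the recursion.

At the last state the moving part is `ℓ + h` with `h` of class `C^1` and left differential `p n`. By
`DiniNonnegAt.neg_mfderiv_mem_limitingSubdiff`, `-dh` is a limiting subgradient of `ℓ`: quadratic
penalties give exact minima nearby, hence Fréchet subgradients converging to `-dh`. -/

section Euclidean

/-! ### First-order lower bounds and penalised minima in a normed space. -/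

variable {E : Type*} [NormedAddCommGroup E] [NormedSpace ℝ E]

/-- The Lipschitz bound carries the estimate from one direction to its neighbours, and compactness
of the unit sphere then makes it uniform in the direction. -/
theorem eventually_sub_le_of_directional [FiniteDimensional ℝ E] {F : E → ℝ} {y₀ : E}
    {K : NNReal} {s : Set E} (hs : s ∈ 𝓝 y₀) (hF : LipschitzOnWith K F s)
    (hdir : ∀ w : E, ∀ ε > 0, ∀ᶠ t : ℝ in 𝓝[>] 0, F y₀ - ε * t ≤ F (y₀ + t • w))
    {ε : ℝ} (hε : 0 < ε) :
    ∀ᶠ y in 𝓝 y₀, F y₀ - ε * ‖y - y₀‖ ≤ F y := by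
  have hsphere : ∀ w ∈ Metric.sphere (0 : E) 1,
      ∀ᶠ z : ℝ × E in 𝓝[>] 0 ×ˢ 𝓝 w, F y₀ - ε * z.1 ≤ F (y₀ + z.1 • z.2) := by
    intro w _
    -- Changing the direction by this much costs at most `ε / 2 * t`; the `+ 1` covers `K = 0`.
    have hη : 0 < ε / (2 * (K + 1)) := by positivity
    have hnear : ∀ᶠ z : ℝ × E in 𝓝[>] 0 ×ˢ 𝓝 w, y₀ + z.1 • z.2 ∈ s := by
      have hc : Tendsto (fun z : ℝ × E => y₀ + z.1 • z.2) (𝓝 (0, w)) (𝓝 y₀) := by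
        have : Continuous fun z : ℝ × E => y₀ + z.1 • z.2 := by fun_prop
        simpa using this.tendsto (0, w)
      rw [nhds_prod_eq] at hc
      exact (hc.mono_left (prod_mono nhdsWithin_le_nhds le_rfl)).eventually_mem hs
    have hnear' : ∀ᶠ z : ℝ × E in 𝓝[>] 0 ×ˢ 𝓝 w, y₀ + z.1 • w ∈ s := by
      have hc : Tendsto (fun z : ℝ × E => y₀ + z.1 • w) (𝓝 (0, w)) (𝓝 y₀) := by
        have : Continuous fun z : ℝ × E => y₀ + z.1 • w := by fun_prop
        simpa using this.tendsto (0, w)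
      rw [nhds_prod_eq] at hc
      exact (hc.mono_left (prod_mono nhdsWithin_le_nhds le_rfl)).eventually_mem hs
    have hd : ∀ᶠ z : ℝ × E in 𝓝[>] 0 ×ˢ 𝓝 w, 0 < z.1 ∧
        F y₀ - ε / 2 * z.1 ≤ F (y₀ + z.1 • w) :=
      tendsto_fst.eventually ((eventually_mem_nhdsWithin).and (hdir w (ε / 2) (half_pos hε)))
    have hb : ∀ᶠ z : ℝ × E in 𝓝[>] 0 ×ˢ 𝓝 w, dist z.2 w < ε / (2 * (K + 1)) :=
      tendsto_snd.eventually (Metric.ball_mem_nhds w hη)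
    filter_upwards [hnear, hnear', hd, hb] with z h1 h2 ⟨h3, h4⟩ h5
    have h6 := hF.dist_le_mul _ h2 _ h1
    rw [Real.dist_eq] at h6
    have h7 : dist (y₀ + z.1 • w) (y₀ + z.1 • z.2) = z.1 * dist z.2 w := by
      rw [dist_add_left, dist_smul₀, Real.norm_of_nonneg h3.le, dist_comm]
    rw [h7] at h6
    have h8 : (K : ℝ) * (z.1 * dist z.2 w) ≤ ε / 2 * z.1 := by
      have : (K : ℝ) * dist z.2 w ≤ ε / 2 := by
        calc (K : ℝ) * dist z.2 w ≤ (K + 1) * (ε / (2 * (K + 1))) := by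
              gcongr
              linarith
          _ = ε / 2 := by field_simp
      calc (K : ℝ) * (z.1 * dist z.2 w) = (K : ℝ) * dist z.2 w * z.1 := by ring
        _ ≤ _ := by gcongr
    linarith [le_abs_self (F (y₀ + z.1 • w) - F (y₀ + z.1 • z.2))]
  have hall : ∀ᶠ t : ℝ in 𝓝[>] 0, ∀ w ∈ Metric.sphere (0 : E) 1,
      F y₀ - ε * t ≤ F (y₀ + t • w) := by
    refine (isCompact_sphere (0 : E) 1).induction_on
      (p := fun A => ∀ᶠ t : ℝ in 𝓝[>] 0, ∀ w ∈ A, F y₀ - ε * t ≤ F (y₀ + t • w))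
      (by simp) (fun A B hAB hB => hB.mono fun t ht w hw => ht w (hAB hw))
      (fun A B hA hB => by
        filter_upwards [hA, hB] with t h1 h2 w hw
        exact hw.elim (h1 w) (h2 w)) ?_
    intro w hw
    obtain ⟨A, hA, B, hB, hAB⟩ := eventually_prod_iff.1 (hsphere w hw)
    exact ⟨{x | B x}, mem_nhdsWithin_of_mem_nhds hB, hA.mono fun t ht x hx => hAB ht hx⟩
  obtain ⟨δ, hδ, hball⟩ := mem_nhdsGT_iff_exists_Ioo_subset.1 hall
  filter_upwards [Metric.ball_mem_nhds y₀ hδ] with y hy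
  rcases eq_or_ne y y₀ with rfl | hne
  · simp
  have hpos : 0 < ‖y - y₀‖ := norm_pos_iff.2 (sub_ne_zero.2 hne)
  have h := hball ⟨hpos, by simpa [dist_eq_norm] using hy⟩ (‖y - y₀‖⁻¹ • (y - y₀))
    (by simp [norm_smul, hpos.ne'])
  rwa [smul_inv_smul₀ hpos.ne', add_sub_cancel] at h

/-- The square of a Euclidean norm of `y - y₀`. -/
noncomputable def euclideanSq [FiniteDimensional ℝ E] (y₀ y : E) : ℝ :=
  ‖toEuclidean (y - y₀)‖ ^ 2

theorem contDiff_euclideanSq [FiniteDimensional ℝ E] (y₀ : E) :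
    ContDiff ℝ ∞ (euclideanSq y₀) :=
  ContDiff.norm_sq ℝ (toEuclidean.contDiff.comp (contDiff_id.sub contDiff_const))

/-- The given norm need not be differentiable, so the penalty uses a Euclidean one; equivalence of
norms supplies the constants. -/
theorem exists_sq_norm_le_euclideanSq (E : Type*) [NormedAddCommGroup E] [NormedSpace ℝ E]
    [FiniteDimensional ℝ E] :
    ∃ C > 0, ∀ y₀ y : E, ‖y - y₀‖ ^ 2 ≤ C * euclideanSq y₀ y := by
  refine ⟨(‖(toEuclidean (E := E)).symm.toContinuousLinearMap‖ + 1) ^ 2, by positivity,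
    fun y₀ y => ?_⟩
  rw [euclideanSq, ← mul_pow]
  gcongr
  calc ‖y - y₀‖ = ‖(toEuclidean (E := E)).symm.toContinuousLinearMap (toEuclidean (y - y₀))‖ := by
        simp
    _ ≤ ‖(toEuclidean (E := E)).symm.toContinuousLinearMap‖ * ‖toEuclidean (y - y₀)‖ :=
        ContinuousLinearMap.le_opNorm _ _
    _ ≤ _ := by gcongr; linarith

theorem exists_norm_fderiv_euclideanSq_le (E : Type*) [NormedAddCommGroup E] [NormedSpace ℝ E]
    [FiniteDimensional ℝ E] :
    ∃ C > 0, ∀ y₀ y : E, ‖fderiv ℝ (euclideanSq y₀) y‖ ≤ C * ‖y - y₀‖ := by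
  set A := (toEuclidean (E := E)).toContinuousLinearMap
  refine ⟨2 * ‖A‖ ^ 2 + 1, by positivity, fun y₀ y => ?_⟩
  have hA : HasFDerivAt (fun y => toEuclidean (y - y₀)) A y := by
    have h := A.hasFDerivAt.comp y ((hasFDerivAt_id y).sub_const y₀)
    rwa [ContinuousLinearMap.comp_id] at h
  have h := hA.norm_sq
  have h' : fderiv ℝ (euclideanSq y₀) y = 2 • (innerSL ℝ (toEuclidean (y - y₀))).comp A :=
    h.fderiv
  rw [h']
  refine ContinuousLinearMap.opNorm_le_bound _ (by positivity) fun w => ?_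
  have h1 : ‖toEuclidean (y - y₀)‖ ≤ ‖A‖ * ‖y - y₀‖ := A.le_opNorm _
  have h2 : ‖A w‖ ≤ ‖A‖ * ‖w‖ := A.le_opNorm _
  have h3 := norm_inner_le_norm (𝕜 := ℝ) (toEuclidean (y - y₀)) (A w)
  have h4 : ‖((2 : ℕ) • (innerSL ℝ (toEuclidean (y - y₀))).comp A) w‖ =
      2 * ‖inner ℝ (toEuclidean (y - y₀)) (A w)‖ := by
    simp [A, -map_sub]
  rw [h4]
  calc 2 * ‖inner ℝ (toEuclidean (y - y₀)) (A w)‖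
      ≤ 2 * ((‖A‖ * ‖y - y₀‖) * (‖A‖ * ‖w‖)) := by
        gcongr
        exact h3.trans (by gcongr)
    _ = 2 * ‖A‖ ^ 2 * ‖y - y₀‖ * ‖w‖ := by ring
    _ ≤ _ := by gcongr; linarith

/-- On the sphere of radius `δ` the penalty outweighs the possible drop of `F`, so the minimum over
the closed ball is interior. -/
theorem exists_isLocalMin_add_euclideanSq [FiniteDimensional ℝ E] {F : E → ℝ} {y₀ : E}
    {s : Set E} (hs : s ∈ 𝓝 y₀) (hF : ContinuousOn F s)
    (hlow : ∀ ε > 0, ∀ᶠ y in 𝓝 y₀, F y₀ - ε * ‖y - y₀‖ ≤ F y) {ε : ℝ} (hε : 0 < ε) :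
    ∃ (k : ℝ) (y : E), ‖y - y₀‖ < ε ∧ IsLocalMin (fun z => F z + k * euclideanSq y₀ z) y ∧
      ‖k • fderiv ℝ (euclideanSq y₀) y‖ ≤ ε := by
  obtain ⟨C, hC, hCle⟩ := exists_sq_norm_le_euclideanSq E
  obtain ⟨D, hD, hDle⟩ := exists_norm_fderiv_euclideanSq_le E
  set η := ε / (2 * C * D) with hηdef
  have hη : 0 < η := by positivity
  obtain ⟨r, hr, hball⟩ := Metric.eventually_nhds_iff_ball.1
    ((hlow η hη).and (eventually_mem_set.2 hs))
  set δ := min (r / 2) ε / 2 with hδdef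
  have hδ : 0 < δ := by positivity
  have hδr : δ < r := by
    have := min_le_left (r / 2) ε
    linarith
  have hδε : δ < ε := by
    have := min_le_right (r / 2) ε
    linarith
  -- The penalty is then at least `2 * η * δ` on the sphere, against a drop of at most `η * δ`,
  -- while its gradient in the ball is at most `k * D * δ = ε`.
  set k := 2 * η * C / δ with hkdef
  have hk : 0 < k := by positivity
  have hsub : Metric.closedBall y₀ δ ⊆ Metric.ball y₀ r := Metric.closedBall_subset_ball hδr
  have hcont : ContinuousOn (fun z => F z + k * euclideanSq y₀ z) (Metric.closedBall y₀ δ) :=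
    (hF.mono fun z hz => (hball z (hsub hz)).2).add
      (continuousOn_const.mul (contDiff_euclideanSq y₀).continuous.continuousOn)
  obtain ⟨y, hy, hmin⟩ := (isCompact_closedBall y₀ δ).exists_isMinOn
    ⟨y₀, Metric.mem_closedBall_self hδ.le⟩ hcont
  have h0 : euclideanSq y₀ y₀ = 0 := by simp [euclideanSq]
  have hyδ : ‖y - y₀‖ ≤ δ := by simpa [dist_eq_norm] using hy
  have hlt : ‖y - y₀‖ < δ := by
    refine lt_of_le_of_ne hyδ fun heq => ?_
    have h1 := (hball y (hsub hy)).1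
    have h2 : F y + k * euclideanSq y₀ y ≤ F y₀ + k * euclideanSq y₀ y₀ :=
      hmin (Metric.mem_closedBall_self hδ.le)
    have h3 := hCle y₀ y
    rw [h0, mul_zero, add_zero] at h2
    rw [heq] at h1 h3
    have h4 : k * δ ^ 2 ≤ k * (C * euclideanSq y₀ y) := by gcongr
    have h5 : k * δ ^ 2 = 2 * η * C * δ := by rw [hkdef]; field_simp
    have h6 : C * (k * euclideanSq y₀ y) ≤ C * (η * δ) :=
      mul_le_mul_of_nonneg_left (by linarith) hC.le
    have h7 : 0 < C * (η * δ) := by positivity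
    nlinarith
  refine ⟨k, y, hlt.trans hδε, hmin.isLocalMin ?_, ?_⟩
  · exact Metric.closedBall_mem_nhds_of_mem (by simpa [dist_eq_norm] using hlt)
  · rw [norm_smul, Real.norm_of_nonneg hk.le]
    calc k * ‖fderiv ℝ (euclideanSq y₀) y‖ ≤ k * (D * δ) := by
          gcongr
          exact (hDle y₀ y).trans (by gcongr)
      _ = ε := by rw [hkdef, hηdef]; field_simp

end Euclidean

/-! ### Product manifolds, cotangent convergence, and normals to the whole manifold. -/

section ManifoldPrelim

variable {E : Type*} [NormedAddCommGroup E] [NormedSpace ℝ E]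
  {H : Type*} [TopologicalSpace H] {I : ModelWithCorners ℝ E H}
  {M : Type*} [TopologicalSpace M] [ChartedSpace H M]

theorem contMDiff_pi {ι : Type*} [Fintype ι]
    {E' : ι → Type*} [∀ i, NormedAddCommGroup (E' i)] [∀ i, NormedSpace ℝ (E' i)]
    {H' : ι → Type*} [∀ i, TopologicalSpace (H' i)] {I' : ∀ i, ModelWithCorners ℝ (E' i) (H' i)}
    {M' : ι → Type*} [∀ i, TopologicalSpace (M' i)] [∀ i, ChartedSpace (H' i) (M' i)]
    {m : ℕ∞ω} {c : M → ∀ i, M' i} (hc : ∀ i, ContMDiff I (I' i) m fun t => c t i) :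
    ContMDiff I (ModelWithCorners.pi I') m c := by
  intro t
  rw [contMDiffAt_iff_target]
  refine ⟨continuousAt_pi.2 fun i => (hc i).continuous.continuousAt, ?_⟩
  rw [contMDiffAt_pi_space]
  exact fun i => (contMDiffAt_iff_target.1 (hc i t)).2

instance boundaryless_pi {ι : Type*} [Fintype ι]
    {E' : ι → Type*} [∀ i, NormedAddCommGroup (E' i)] [∀ i, NormedSpace ℝ (E' i)]
    {H' : ι → Type*} [∀ i, TopologicalSpace (H' i)] (I' : ∀ i, ModelWithCorners ℝ (E' i) (H' i))
    [∀ i, (I' i).Boundaryless] : (ModelWithCorners.pi I').Boundaryless where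
  range_eq_univ := by
    refine range_eq_univ.2 fun y => ⟨fun i => (I' i).symm (y i), funext fun i => ?_⟩
    exact (I' i).right_inv (by simp [(I' i).range_eq_univ])

theorem IsLocalMax.mfderiv_eq_zero [I.Boundaryless] {f : M → ℝ} {q : M} (h : IsLocalMax f q) :
    mfderiv I 𝓘(ℝ, ℝ) f q = 0 := by
  by_cases hf : MDifferentiableAt I 𝓘(ℝ, ℝ) f q
  · rw [hf.mfderiv, I.range_eq_univ, fderivWithin_univ]
    have h' : IsLocalMax (writtenInExtChartAt I 𝓘(ℝ, ℝ) q f) (extChartAt I q q) := by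
      refine IsMaxFilter.comp_tendsto (l := 𝓝 q) ?_ ?_
      · rwa [extChartAt_to_inv]
      · simpa [ContinuousAt] using continuousAt_extChartAt_symm (I := I) q
    exact h'.fderiv_eq_zero
  · exact mfderiv_zero_of_not_mdifferentiableAt hf

variable [IsManifold I 1 M]

/-- The line bundle is trivialised by the identity, so the fibre coordinate of a covector is its
composition with the inverse tangent trivialization. -/
theorem tendsto_cotangentBundle_iff {α : Type*} {l : Filter α} {P : α → CotangentBundle I M}
    {q : M} {p : Covector I q} :
    Tendsto P l (𝓝 ⟨q, p⟩) ↔ Tendsto (fun k => (P k).1) l (𝓝 q) ∧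
      Tendsto (fun k => ((P k).2.comp
        ((trivializationAt E (TangentSpace I : M → Type _) q).symmL ℝ (P k).1) : E →L[ℝ] ℝ)) l
        (𝓝 (p.comp ((trivializationAt E (TangentSpace I : M → Type _) q).symmL ℝ q))) := by
  have hval : ∀ k : CotangentBundle I M,
      (trivializationAt (E →L[ℝ] ℝ) (fun q : M => Covector I q) q k).2 = k.2.comp
        ((trivializationAt E (TangentSpace I : M → Type _) q).symmL ℝ k.1) := by
    intro k
    rw [hom_trivializationAt_apply]
    ext v
    exact DFunLike.congr_fun (Bundle.Trivial.continuousLinearMapAt_trivialization ℝ M ℝ k.1) _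
  have h := (trivializationAt (E →L[ℝ] ℝ) (fun q : M => Covector I q) q).tendsto_nhds_iff
    (f := P) (l := l) (z := ⟨q, p⟩)
    (FiberBundle.mem_trivializationAt_proj_source (x := (⟨q, p⟩ : CotangentBundle I M)))
  simp only [hval] at h
  exact h

/-- Here `chi` vanishes identically, so each test function has a local maximum and zero
differential; zero survives the limit. -/
theorem limitingNormalCone_univ_subset [I.Boundaryless] (q : M) :
    limitingNormalCone I (univ : Set M) q ⊆ {0} := by
  rintro p ⟨P, hP, -, hlim⟩
  have hzero : ∀ k, (P k).2 = 0 := by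
    intro k
    obtain ⟨g, -, hg, hmin⟩ := hP k
    rw [hg]
    refine IsLocalMax.mfderiv_eq_zero ?_
    filter_upwards [hmin] with x hx
    simpa [chi] using hx
  have h := (tendsto_cotangentBundle_iff.1 hlim).2
  simp only [hzero, ContinuousLinearMap.zero_comp] at h
  have h0 := tendsto_nhds_unique h (tendsto_const_nhds (x := (0 : E →L[ℝ] ℝ)))
  ext v
  have h1 := DFunLike.congr_fun h0
    ((trivializationAt E (TangentSpace I : M → Type _) q).continuousLinearMapAt ℝ q v)
  have h2 := (trivializationAt E (TangentSpace I : M → Type _) q).symmL_continuousLinearMapAt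
    (R := ℝ) (mem_baseSet_trivializationAt E (TangentSpace I : M → Type _) q) v
  rw [ContinuousLinearMap.comp_apply, h2] at h1
  exact h1

theorem IsCritical.zero_le_liminf [I.Boundaryless] {J : M → ℝ} {c : ℝ → M}
    (hu : IsCritical I univ J (c 0)) (hc : ContMDiff 𝓘(ℝ, ℝ) I ∞ c) :
    0 ≤ liminf (fun t : ℝ => (((J (c t) - J (c 0)) / t : ℝ) : EReal)) (𝓝[>] 0) := by
  refine (hu.2 (mfderiv 𝓘(ℝ, ℝ) I c 0 (1 : ℝ)) fun p hp => ?_).trans (iInf₂_le c ⟨hc, rfl⟩)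
  rw [limitingNormalCone_univ_subset _ hp]
  simp

end ManifoldPrelim

/-! ### From Dini derivatives to differentials and limiting subgradients. -/

section ManifoldDini

variable {E : Type*} [NormedAddCommGroup E] [NormedSpace ℝ E]
  {H : Type*} [TopologicalSpace H] {I : ModelWithCorners ℝ E H}
  {M : Type*} [TopologicalSpace M] [ChartedSpace H M]

variable (I) in
/-- The lower Dini derivative of `f` along every smooth curve through `q` is nonnegative. -/
def DiniNonnegAt (f : M → ℝ) (q : M) : Prop :=
  ∀ c : ℝ → M, ContMDiff 𝓘(ℝ, ℝ) I ∞ c → c 0 = q →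
    0 ≤ liminf (fun t : ℝ => (((f (c t) - f q) / t : ℝ) : EReal)) (𝓝[>] 0)

/-- A coordinate segment may leave the chart; damping its parameter by a bump function keeps it
inside for all times without changing it near `0`. -/
theorem exists_contMDiff_curve [I.Boundaryless] [IsManifold I ∞ M] (q : M) (w : E) :
    ∃ c : ℝ → M, ContMDiff 𝓘(ℝ, ℝ) I ∞ c ∧ c 0 = q ∧
      ∀ᶠ t in 𝓝 (0 : ℝ), c t = (extChartAt I q).symm (extChartAt I q q + t • w) := by
  obtain ⟨r, hr, hball⟩ := Metric.mem_nhds_iff.1 (extChartAt_target_mem_nhds (I := I) q)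
  set ρ := r / (‖w‖ + 1) with hρ
  have hρ0 : 0 < ρ := by positivity
  let χ : ContDiffBump (0 : ℝ) := ⟨ρ / 2, ρ, half_pos hρ0, half_lt_self hρ0⟩
  have hmaps : ∀ t : ℝ, extChartAt I q q + (χ t * t) • w ∈ (extChartAt I q).target := by
    intro t
    refine hball ?_
    rw [Metric.mem_ball, dist_eq_norm, add_sub_cancel_left, norm_smul]
    have h1 : ‖χ t * t‖ ≤ ρ := by
      rw [norm_mul, Real.norm_of_nonneg χ.nonneg]
      by_cases ht : ‖t‖ < ρ
      · calc χ t * ‖t‖ ≤ 1 * ‖t‖ := by gcongr; exact χ.le_one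
          _ ≤ ρ := by linarith
      · rw [χ.zero_of_le_dist (by simpa [dist_eq_norm] using not_lt.1 ht), zero_mul]
        exact hρ0.le
    calc ‖χ t * t‖ * ‖w‖ ≤ ρ * ‖w‖ := by gcongr
      _ < ρ * (‖w‖ + 1) := by gcongr; linarith
      _ = r := by rw [hρ]; field_simp
  refine ⟨fun t => (extChartAt I q).symm (extChartAt I q q + (χ t * t) • w), ?_, by simp, ?_⟩
  · refine (contMDiffOn_extChartAt_symm q).comp_contMDiff (f := fun t : ℝ =>
      extChartAt I q q + (χ t * t) • w) ?_ hmaps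
    rw [contMDiff_iff_contDiff]
    exact contDiff_const.add ((χ.contDiff.mul contDiff_id).smul contDiff_const)
  · filter_upwards [χ.eventuallyEq_one] with t ht
    rw [ht]
    simp

theorem DiniNonnegAt.directional [I.Boundaryless] [IsManifold I ∞ M] {f : M → ℝ} {q : M}
    (hf : DiniNonnegAt I f q) (w : E) {ε : ℝ} (hε : 0 < ε) :
    ∀ᶠ t : ℝ in 𝓝[>] 0, (f ∘ (extChartAt I q).symm) (extChartAt I q q) - ε * t ≤
      (f ∘ (extChartAt I q).symm) (extChartAt I q q + t • w) := by
  obtain ⟨c, hc, hc0, hct⟩ := exists_contMDiff_curve (I := I) q w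
  have hlt : ((-ε : ℝ) : EReal) <
      liminf (fun t : ℝ => (((f (c t) - f q) / t : ℝ) : EReal)) (𝓝[>] 0) :=
    lt_of_lt_of_le (by exact_mod_cast neg_lt_zero.2 hε) (hf c hc hc0)
  filter_upwards [eventually_lt_of_lt_liminf hlt, hct.filter_mono nhdsWithin_le_nhds,
    eventually_mem_nhdsWithin] with t h1 h2 h3
  rw [EReal.coe_lt_coe_iff, lt_div_iff₀ h3, h2] at h1
  simp only [Function.comp_apply, extChartAt_to_inv]
  linarith

theorem ContMDiff.contDiffAt_comp_extChartAt_symm [I.Boundaryless] {n : ℕ∞ω} [IsManifold I n M]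
    {f : M → ℝ} (hf : ContMDiff I 𝓘(ℝ, ℝ) n f) (q : M) {y : E}
    (hy : y ∈ (extChartAt I q).target) :
    ContDiffAt ℝ n (f ∘ (extChartAt I q).symm) y := by
  rw [← contMDiffAt_iff_contDiffAt]
  exact hf.contMDiffAt.comp y ((contMDiffOn_extChartAt_symm q).contMDiffAt
    ((isOpen_extChartAt_target q).mem_nhds hy))

/-- The change of charts is `C^1`, hence locally Lipschitz. -/
theorem LocallyLipschitzMfd.exists_lipschitzOnWith [I.Boundaryless] [IsManifold I ∞ M]
    {f : M → ℝ} (hf : LocallyLipschitzMfd I f) (q : M) :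
    ∃ K : NNReal, ∃ s ∈ 𝓝 (extChartAt I q q),
      LipschitzOnWith K (f ∘ (extChartAt I q).symm) s := by
  obtain ⟨φ, hφ, hq, K, hK⟩ := hf q
  have hsymm : ContMDiffAt 𝓘(ℝ, E) I ∞ (extChartAt I q).symm (extChartAt I q q) :=
    (contMDiffOn_extChartAt_symm q).contMDiffAt (extChartAt_target_mem_nhds q)
  have hτ : ContDiffAt ℝ 1 (φ.extend I ∘ (extChartAt I q).symm) (extChartAt I q q) := by
    rw [← contMDiffAt_iff_contDiffAt]
    refine ContMDiffAt.of_le (n := ∞) ?_ (by simp)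
    exact (φ.contMDiffAt_extend hφ (by simpa using hq)).comp _ hsymm
  obtain ⟨K', s, hs, hK'⟩ := hτ.exists_lipschitzOnWith
  have hsrc : (extChartAt I q).symm ⁻¹' φ.source ∈ 𝓝 (extChartAt I q q) :=
    hsymm.continuousAt.preimage_mem_nhds (φ.open_source.mem_nhds (by simpa using hq))
  refine ⟨K * K', s ∩ (extChartAt I q).symm ⁻¹' φ.source, inter_mem hs hsrc, ?_⟩
  have h := hK.comp (hK'.mono inter_subset_left) (s := s ∩ (extChartAt I q).symm ⁻¹' φ.source)
    (fun y hy => ⟨_, hy.2, rfl⟩)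
  intro x hx y hy
  have hval : ∀ z ∈ s ∩ (extChartAt I q).symm ⁻¹' φ.source,
      ((f ∘ (φ.extend I).symm) ∘ (φ.extend I ∘ (extChartAt I q).symm)) z =
        (f ∘ (extChartAt I q).symm) z := by
    intro z hz
    simp only [Function.comp_apply]
    rw [φ.extend_left_inv hz.2]
  have h' := h hx hy
  rwa [hval x hx, hval y hy] at h'

theorem DiniNonnegAt.eventually_sub_le [FiniteDimensional ℝ E] [I.Boundaryless]
    [IsManifold I ∞ M] {f : M → ℝ} {q : M} (hf : DiniNonnegAt I f q)
    {K : NNReal} {s : Set E} (hs : s ∈ 𝓝 (extChartAt I q q))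
    (hK : LipschitzOnWith K (f ∘ (extChartAt I q).symm) s) {ε : ℝ} (hε : 0 < ε) :
    ∀ᶠ y in 𝓝 (extChartAt I q q),
      (f ∘ (extChartAt I q).symm) (extChartAt I q q) - ε * ‖y - extChartAt I q q‖ ≤
        (f ∘ (extChartAt I q).symm) y :=
  eventually_sub_le_of_directional hs hK (fun w _ hε' => hf.directional w hε') hε

variable [IsManifold I 1 M]

theorem mfderiv_comp_symmL_trivializationAt [I.Boundaryless] {f : M → ℝ}
    (hf : MDifferentiable I 𝓘(ℝ, ℝ) f) (q : M) {x : M} {y : E}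
    (hy : y ∈ (extChartAt I q).target) (hx : (extChartAt I q).symm y = x) :
    (ContinuousLinearMap.comp (mfderiv I 𝓘(ℝ, ℝ) f x)
      ((trivializationAt E (TangentSpace I : M → Type _) q).symmL ℝ x) : E →L[ℝ] ℝ) =
      fderiv ℝ (f ∘ (extChartAt I q).symm) y := by
  subst hx
  have hsrc : (extChartAt I q).symm y ∈ (chartAt H q).source := by
    simpa using (extChartAt I q).map_target hy
  have hd : MDifferentiableAt 𝓘(ℝ, E) I (extChartAt I q).symm y :=
    ((contMDiffOn_extChartAt_symm (n := 1) q).contMDiffAt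
      ((isOpen_extChartAt_target q).mem_nhds hy)).mdifferentiableAt (by simp)
  rw [TangentBundle.symmL_trivializationAt hsrc, (extChartAt I q).right_inv hy,
    I.range_eq_univ, mfderivWithin_univ, ← mfderiv_eq_fderiv, mfderiv_comp y (hf _) hd]
  rfl

theorem DiniNonnegAt.mfderiv_eq_zero [I.Boundaryless] [IsManifold I ∞ M] {f : M → ℝ} {q : M}
    (hf : DiniNonnegAt I f q) (hd : MDifferentiable I 𝓘(ℝ, ℝ) f) :
    mfderiv I 𝓘(ℝ, ℝ) f q = 0 := by
  have hF : DifferentiableAt ℝ (f ∘ (extChartAt I q).symm) (extChartAt I q q) := by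
    rw [← mdifferentiableAt_iff_differentiableAt]
    refine (hd _).comp _ (((contMDiffOn_extChartAt_symm (n := 1) q).contMDiffAt
      (extChartAt_target_mem_nhds q)).mdifferentiableAt (by simp))
  have hnonneg : ∀ w, 0 ≤ fderiv ℝ (f ∘ (extChartAt I q).symm) (extChartAt I q q) w := by
    intro w
    have hlim := (hF.hasFDerivAt.hasLineDerivAt w).tendsto_slope_zero_right
    refine le_of_forall_pos_le_add fun ε hε => ?_
    rw [← neg_le_iff_add_nonneg]
    refine ge_of_tendsto hlim ?_
    filter_upwards [hf.directional w hε, eventually_mem_nhdsWithin] with t h1 h2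
    rw [smul_eq_mul, inv_mul_eq_div, le_div_iff₀ h2]
    linarith
  rw [(hd q).mfderiv, I.range_eq_univ, fderivWithin_univ]
  ext w
  have h1 := hnonneg w
  have h2 := hnonneg (-w)
  rw [map_neg] at h2
  exact le_antisymm (neg_nonneg.1 h2) h1

theorem DiniNonnegAt.neg_mfderiv_mem_limitingSubdiff [FiniteDimensional ℝ E] [T2Space M]
    [I.Boundaryless] [IsManifold I ∞ M] {ℓ h : M → ℝ} {q : M} (hℓ : LocallyLipschitzMfd I ℓ)
    (hh : ContMDiff I 𝓘(ℝ, ℝ) 1 h) (hf : DiniNonnegAt I (fun x => ℓ x + h x) q) :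
    -mfderiv I 𝓘(ℝ, ℝ) h q ∈ limitingSubdiff I (fun x => (ℓ x : EReal)) q := by
  set y₀ := extChartAt I q q with hy₀
  set σ := (extChartAt I q).symm with hσ
  have htgt : (extChartAt I q).target ∈ 𝓝 y₀ := extChartAt_target_mem_nhds q
  have hσy₀ : σ y₀ = q := extChartAt_to_inv q
  have hσc : ContinuousAt σ y₀ := continuousAt_extChartAt_symm q
  have hhC : ContDiffAt ℝ 1 (h ∘ σ) y₀ :=
    hh.contDiffAt_comp_extChartAt_symm q (mem_of_mem_nhds htgt)
  obtain ⟨K, s, hs, hK⟩ := hℓ.exists_lipschitzOnWith q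
  obtain ⟨K', s', hs', hK'⟩ := hhC.exists_lipschitzOnWith
  have hKK : LipschitzOnWith (K + K') ((fun x => ℓ x + h x) ∘ σ) (s ∩ s') :=
    (hK.mono inter_subset_left).add (hK'.mono inter_subset_right)
  obtain ⟨χ⟩ : Nonempty (SmoothBumpFunction I q) := inferInstance
  -- Test functions for Fréchet subgradients are global, so the penalty is cut off; it is unchanged
  -- where the bump equals `1`.
  set N : M → ℝ := fun x => χ x • euclideanSq y₀ (extChartAt I q x) with hN
  have hNC : ContMDiff I 𝓘(ℝ, ℝ) 1 N := by
    refine ContMDiff.of_le (n := ∞) (χ.contMDiff_smul ?_) (by simp)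
    exact (contDiff_euclideanSq y₀).contMDiff.comp_contMDiffOn contMDiffOn_extChartAt
  have hσt : Tendsto σ (𝓝 y₀) (𝓝 q) := by
    have := hσc.tendsto
    rwa [hσy₀] at this
  have hstep : ∀ n : ℕ, ∃ (k : ℝ) (y : E), y ∈ (extChartAt I q).target ∧
      ‖y - y₀‖ < 1 / (n + 1 : ℝ) ∧
      (∀ᶠ z in 𝓝 y, N (σ z) = euclideanSq y₀ z) ∧
      IsLocalMin (fun z => ((fun x => ℓ x + h x) ∘ σ) z + k * euclideanSq y₀ z) y ∧
      ‖k • fderiv ℝ (euclideanSq y₀) y‖ ≤ 1 / (n + 1 : ℝ) := by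
    intro n
    obtain ⟨r, hr, hball⟩ := Metric.mem_nhds_iff.1 htgt
    obtain ⟨k, y, h1, h2, h3⟩ := exists_isLocalMin_add_euclideanSq (inter_mem hs hs')
      hKK.continuousOn (fun ε hε => hf.eventually_sub_le (inter_mem hs hs') hKK hε)
      (ε := min (1 / (n + 1 : ℝ)) (min r χ.rIn))
      (lt_min (by positivity) (lt_min hr χ.rIn_pos))
    obtain ⟨h4, h5⟩ := lt_min_iff.1 h1
    obtain ⟨h6, h7⟩ := lt_min_iff.1 h5
    have hyt : y ∈ (extChartAt I q).target := hball (by rwa [Metric.mem_ball, dist_eq_norm])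
    refine ⟨k, y, hyt, h4, ?_, h2, h3.trans (min_le_left _ _)⟩
    filter_upwards [(isOpen_extChartAt_target q).mem_nhds hyt,
      Metric.isOpen_ball.mem_nhds (show y ∈ Metric.ball y₀ χ.rIn by
        rwa [Metric.mem_ball, dist_eq_norm])] with z hz hzb
    have hzs : σ z ∈ (chartAt H q).source := by
      rw [← extChartAt_source I]
      exact (extChartAt I q).map_target hz
    have hzr : extChartAt I q (σ z) = z := (extChartAt I q).right_inv hz
    simp only [hN, hzr]
    rw [χ.one_of_dist_le hzs (by rw [hzr]; exact (Metric.mem_ball.1 hzb).le), one_smul]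
  choose k y hyt hyε hyN hymin hyd using hstep
  have hφC : ∀ n, ContMDiff I 𝓘(ℝ, ℝ) 1 fun x => -h x - k n * N x := fun n =>
    hh.neg.sub (contMDiff_const.mul hNC)
  have hy : Tendsto y atTop (𝓝 y₀) := by
    rw [tendsto_iff_norm_sub_tendsto_zero]
    exact squeeze_zero (fun _ => norm_nonneg _) (fun n => (hyε n).le)
      tendsto_one_div_add_atTop_nhds_zero_nat
  -- A local minimum of `ℓ + h + k N` is one of `ℓ - (-h - k N)`.
  refine ⟨fun n => ⟨σ (y n), mfderiv I 𝓘(ℝ, ℝ) (fun x => -h x - k n * N x) (σ (y n))⟩,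
    fun n => ⟨_, hφC n, rfl, ?_⟩, ?_, ?_⟩
  · have hsrc : σ (y n) ∈ (extChartAt I q).source := (extChartAt I q).map_target (hyt n)
    have hc : ContinuousAt (extChartAt I q) (σ (y n)) := continuousAt_extChartAt' hsrc
    have hcy : extChartAt I q (σ (y n)) = y n := (extChartAt I q).right_inv (hyt n)
    rw [ContinuousAt, hcy] at hc
    filter_upwards [hc.eventually (hymin n), hc.eventually (hyN n),
      (isOpen_extChartAt_source q).mem_nhds hsrc] with x h1 h2 h3
    have hx : σ (extChartAt I q x) = x := (extChartAt I q).left_inv h3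
    simp only [Function.comp_apply, hx] at h1 h2
    have h4 := (hyN n).self_of_nhds
    rw [← EReal.coe_sub, ← EReal.coe_sub, EReal.coe_le_coe_iff, h2, h4]
    linarith
  · have h1 : ContinuousAt (ℓ ∘ σ) y₀ := hK.continuousOn.continuousAt hs
    have h2 := h1.tendsto.comp hy
    rw [Function.comp_apply, hσy₀] at h2
    exact (continuous_coe_real_ereal.tendsto _).comp h2
  · refine tendsto_cotangentBundle_iff.2 ⟨hσt.comp hy, ?_⟩
    have hfd : ∀ n, fderiv ℝ ((fun x => -h x - k n * N x) ∘ σ) (y n) =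
        -fderiv ℝ (h ∘ σ) (y n) - k n • fderiv ℝ (euclideanSq y₀) (y n) := by
      intro n
      have heq : ((fun x => -h x - k n * N x) ∘ σ) =ᶠ[𝓝 (y n)]
          fun z => -(h ∘ σ) z - k n * euclideanSq y₀ z := by
        filter_upwards [hyN n] with z hz
        simp [hz]
      rw [heq.fderiv_eq]
      have d1 : DifferentiableAt ℝ (h ∘ σ) (y n) :=
        (hh.contDiffAt_comp_extChartAt_symm q (hyt n)).differentiableAt (by simp)
      have d2 : DifferentiableAt ℝ (euclideanSq y₀) (y n) :=
        (contDiff_euclideanSq y₀).differentiable (by simp) _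
      exact (d1.hasFDerivAt.neg.sub (d2.hasFDerivAt.const_mul (k n))).fderiv
    have hlim : Tendsto (fun n => -fderiv ℝ (h ∘ σ) (y n) -
        k n • fderiv ℝ (euclideanSq y₀) (y n)) atTop (𝓝 (-fderiv ℝ (h ∘ σ) y₀)) := by
      have h1 := ((hhC.continuousAt_fderiv (by simp)).tendsto.comp hy).neg
      have h2 : Tendsto (fun n => k n • fderiv ℝ (euclideanSq y₀) (y n)) atTop (𝓝 0) :=
        squeeze_zero_norm hyd tendsto_one_div_add_atTop_nhds_zero_nat
      simpa using h1.sub h2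
    have htarget := mfderiv_comp_symmL_trivializationAt (hh.mdifferentiable (by simp)) q
      (mem_of_mem_nhds htgt) hσy₀
    have htarget' : -fderiv ℝ (h ∘ σ) y₀ = ContinuousLinearMap.comp (-mfderiv I 𝓘(ℝ, ℝ) h q)
        ((trivializationAt E (TangentSpace I : M → Type _) q).symmL ℝ q) := by
      rw [hσ, ← htarget]
      rfl
    rw [htarget'] at hlim
    refine hlim.congr fun n => ?_
    rw [← hfd n]
    exact (mfderiv_comp_symmL_trivializationAt ((hφC n).mdifferentiable (by simp)) q
      (hyt n) rfl).symm

end ManifoldDini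

/-! ### Left-trivialised differentials and the coadjoint action. -/

section LieDerivatives

variable {E : Type*} [NormedAddCommGroup E] [NormedSpace ℝ E]
  {H : Type*} [TopologicalSpace H] {I : ModelWithCorners ℝ E H}
  {G : Type*} [TopologicalSpace G] [ChartedSpace H G]

variable (I) in
/-- The manifold derivative of a real function, as a linear form. -/
noncomputable def differentialAt (f : G → ℝ) (x : G) : TangentSpace I x →L[ℝ] ℝ :=
  mfderiv I 𝓘(ℝ, ℝ) f x

theorem differentialAt_diag {f : G × G → ℝ} {a : G}
    (hf : MDifferentiableAt (I.prod I) 𝓘(ℝ, ℝ) f (a, a)) :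
    differentialAt I (fun z => f (z, z)) a =
      differentialAt I (fun z => f (z, a)) a + differentialAt I (fun z => f (a, z)) a := by
  have hd : HasMFDerivAt I (I.prod I) (fun z : G => (z, z)) a
      ((ContinuousLinearMap.id ℝ (TangentSpace I a)).prod
        (ContinuousLinearMap.id ℝ (TangentSpace I a))) :=
    (hasMFDerivAt_id a).prodMk (hasMFDerivAt_id a)
  have h1 : differentialAt I (fun z => f (z, z)) a =
      (mfderiv (I.prod I) 𝓘(ℝ, ℝ) f (a, a)).comp
        ((ContinuousLinearMap.id ℝ (TangentSpace I a)).prod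
        (ContinuousLinearMap.id ℝ (TangentSpace I a))) :=
    (HasMFDerivAt.comp (f := fun z : G => (z, z)) a hf.hasMFDerivAt hd).mfderiv
  rw [h1]
  ext v
  exact mfderiv_prod_eq_add_apply hf

variable [Group G]

theorem leftDifferential_eq_differentialAt [ContMDiffMul I ∞ G] {f : G → ℝ} {g : G}
    (hf : MDifferentiableAt I 𝓘(ℝ, ℝ) f g) :
    leftDifferential I f g = differentialAt I (fun y => f (g * y)) 1 := by
  have hm : MDifferentiableAt I I (fun y : G => g * y) 1 :=
    (contMDiff_mul_left (n := ∞)).mdifferentiable (by simp) 1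
  have h1 : differentialAt I (fun y => f (g * y)) 1 =
      (differentialAt I f (g * 1) : E →L[ℝ] ℝ).comp
        (mfderiv I I (fun y : G => g * y) 1 : E →L[ℝ] E) :=
    mfderiv_comp_of_eq hf hm (mul_one g)
  -- The type of the differential depends on the base point, so `g * 1` and `g` are compared through
  -- forms on `E`.
  have h2 : ∀ x, x = g → (differentialAt I f x : E →L[ℝ] ℝ) = differentialAt I f g := by
    rintro _ rfl
    rfl
  rw [h1]
  exact congrArg (fun D : E →L[ℝ] ℝ => D.comp (mfderiv I I (fun y : G => g * y) 1))
    (h2 _ (mul_one g)).symm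

theorem lieAdDual_leftDifferential [LieGroup I ∞ G] {f : G → ℝ} {g : G}
    (hf : MDifferentiableAt I 𝓘(ℝ, ℝ) f g) (u : G) :
    lieAdDual I u (leftDifferential I f g) =
      differentialAt I (fun z => f (g * (u * z * u⁻¹))) 1 := by
  have hc : MDifferentiableAt I I (fun z : G => u * z * u⁻¹) 1 :=
    ((contMDiff_const.mul contMDiff_id).mul (contMDiff_const (n := ∞))).mdifferentiable
      (by simp) 1
  have he : u * 1 * u⁻¹ = 1 := by group
  have hfm : MDifferentiableAt I 𝓘(ℝ, ℝ) (fun y => f (g * y)) 1 := by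
    refine MDifferentiableAt.comp (I' := I) 1 (g := f) (by simpa using hf) ?_
    exact (contMDiff_mul_left (n := ∞)).mdifferentiable (by simp) 1
  have h1 : differentialAt I (fun z => f (g * (u * z * u⁻¹))) 1 =
      (differentialAt I (fun y => f (g * y)) (u * 1 * u⁻¹) : E →L[ℝ] ℝ).comp
        (mfderiv I I (fun z : G => u * z * u⁻¹) 1 : E →L[ℝ] E) :=
    mfderiv_comp_of_eq (g := fun y => f (g * y)) hfm hc he
  have h2 : ∀ x : G, x = 1 → (differentialAt I (fun y => f (g * y)) x : E →L[ℝ] ℝ) =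
      differentialAt I (fun y => f (g * y)) 1 := by
    rintro _ rfl
    rfl
  rw [h1, leftDifferential_eq_differentialAt hf]
  exact congrArg (fun D : E →L[ℝ] ℝ => D.comp (mfderiv I I (fun z : G => u * z * u⁻¹) 1))
    (h2 _ he).symm

/-- The function `f (z.1⁻¹ * z.2)` is constant on the diagonal, so its two partial differentials
cancel. -/
theorem differentialAt_comp_inv_one [LieGroup I ∞ G] {f : G → ℝ}
    (hf : ContMDiff I 𝓘(ℝ, ℝ) 1 f) :
    differentialAt I (fun z => f z⁻¹) (1 : G) = -differentialAt I f 1 := by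
  have hΨ : ContMDiff (I.prod I) 𝓘(ℝ, ℝ) 1 fun z : G × G => f (z.1⁻¹ * z.2) :=
    hf.comp (((contMDiff_fst.inv).mul (contMDiff_snd (n := ∞))).of_le (by simp))
  have h := differentialAt_diag (hΨ.mdifferentiable (by simp) ((1 : G), (1 : G)))
  have h0 : differentialAt I (fun _ : G => f 1) 1 = 0 := mfderiv_const
  simp only [inv_mul_cancel, mul_one, inv_one, one_mul, h0] at h
  exact eq_neg_of_add_eq_zero_left h.symm

/-- With `u = g⁻¹ * b`, the motion `x = g * (u * z * u⁻¹)` gives `x⁻¹ * b = u * z⁻¹`. The first slot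
yields the `Ad^*` term, and the inversion in the second yields the minus sign. -/
theorem lieAdDual_leftDifferential_pair [LieGroup I ∞ G] {L : G × G → ℝ}
    (hL : ContMDiff (I.prod I) 𝓘(ℝ, ℝ) 1 L) (g b : G) :
    lieAdDual I (g⁻¹ * b) (leftDifferential I (fun x => L (x, x⁻¹ * b)) g) =
      lieAdDual I (g⁻¹ * b) (leftDifferential I (fun x => L (x, g⁻¹ * b)) g) -
        leftDifferential I (fun w => L (g, w)) (g⁻¹ * b) := by
  have hLx : ContMDiff I 𝓘(ℝ, ℝ) 1 fun x => L (x, x⁻¹ * b) :=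
    hL.comp ((contMDiff_id.prodMk
      ((contMDiff_id.inv).mul (contMDiff_const (n := ∞)))).of_le (by simp))
  have hL1 : ContMDiff I 𝓘(ℝ, ℝ) 1 fun x => L (x, g⁻¹ * b) :=
    hL.comp (contMDiff_id.prodMk contMDiff_const)
  have hL2 : ContMDiff I 𝓘(ℝ, ℝ) 1 fun w => L (g, w) :=
    hL.comp (contMDiff_const.prodMk contMDiff_id)
  have hL2m : ContMDiff I 𝓘(ℝ, ℝ) 1 fun w => L (g, g⁻¹ * b * w) :=
    hL2.comp ((contMDiff_mul_left (n := ∞)).of_le (by simp))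
  rw [lieAdDual_leftDifferential (hLx.mdifferentiable (by simp) _),
    lieAdDual_leftDifferential (hL1.mdifferentiable (by simp) _),
    leftDifferential_eq_differentialAt (hL2.mdifferentiable (by simp) _)]
  generalize hu : g⁻¹ * b = u at *
  have hΨ : ContMDiff (I.prod I) 𝓘(ℝ, ℝ) 1
      fun z : G × G => L (g * (u * z.1 * u⁻¹), u * z.2⁻¹) := by
    refine hL.comp (ContMDiff.of_le (n := ∞) (ContMDiff.prodMk ?_ ?_) (by simp))
    · exact contMDiff_const.mul ((contMDiff_const.mul contMDiff_fst).mul contMDiff_const)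
    · exact contMDiff_const.mul contMDiff_snd.inv
  have h := differentialAt_diag (hΨ.mdifferentiable (by simp) ((1 : G), (1 : G)))
  have hinv := differentialAt_comp_inv_one hL2m
  have e1 : (fun z => L (g * (u * z * u⁻¹), (g * (u * z * u⁻¹))⁻¹ * b)) =
      fun z => L (g * (u * z * u⁻¹), u * z⁻¹) := by
    funext z
    congr 2
    rw [← hu]
    group
  simp only [mul_one, inv_one, mul_inv_cancel, hinv] at h
  rw [e1, h, sub_eq_add_neg]

theorem leftDifferential_comp_mul_left [LieGroup I ∞ G] {f : G → ℝ}
    (hf : ContMDiff I 𝓘(ℝ, ℝ) 1 f) (a g : G) :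
    leftDifferential I (fun x => f (a * x)) g = leftDifferential I f (a * g) := by
  have hfa : ContMDiff I 𝓘(ℝ, ℝ) 1 fun x => f (a * x) :=
    hf.comp ((contMDiff_mul_left (n := ∞)).of_le (by simp))
  rw [leftDifferential_eq_differentialAt (hfa.mdifferentiable (by simp) _),
    leftDifferential_eq_differentialAt (hf.mdifferentiable (by simp) _)]
  simp only [mul_assoc]

theorem leftDifferential_add {f f' : G → ℝ} {g : G}
    (hf : MDifferentiableAt I 𝓘(ℝ, ℝ) f g) (hf' : MDifferentiableAt I 𝓘(ℝ, ℝ) f' g) :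
    leftDifferential I (fun x => f x + f' x) g =
      leftDifferential I f g + leftDifferential I f' g := by
  have h : differentialAt I (fun x => f x + f' x) g =
      differentialAt I f g + differentialAt I f' g := mfderiv_add hf hf'
  exact (congrArg (toLieDual I g) h).trans (ContinuousLinearMap.add_comp _ _ _)

end LieDerivatives

/-! ### The cost as a function of the states. -/

section Trajectories

variable {G : Type*} [Group G] {n : ℕ}

theorem stateSeq_inv_mul (y : Fin (n + 1) → G) :
    stateSeq (fun _ x w => x * w) (y 0) (fun i : Fin n => (y i.castSucc)⁻¹ * y i.succ) = y := by
  funext i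
  induction i using Fin.induction with
  | zero => rfl
  | succ i ih =>
    have h : stateSeq (fun _ x w => x * w) (y 0)
        (fun i : Fin n => (y i.castSucc)⁻¹ * y i.succ) i.succ =
        stateSeq (fun _ x w => x * w) (y 0)
          (fun i : Fin n => (y i.castSucc)⁻¹ * y i.succ) i.castSucc *
            ((y i.castSucc)⁻¹ * y i.succ) := rfl
    rw [h, ih, mul_inv_cancel_left]

theorem control_eq_inv_mul (g₀ : G) (u : Fin n → G) (i : Fin n) :
    u i = (stateSeq (fun _ x w => x * w) g₀ u i.castSucc)⁻¹ *
      stateSeq (fun _ x w => x * w) g₀ u i.succ := by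
  have h : stateSeq (fun _ x w => x * w) g₀ u i.succ =
      stateSeq (fun _ x w => x * w) g₀ u i.castSucc * u i := rfl
  rw [h, inv_mul_cancel_left]

/-- The cost of a control sequence, as a function of the states that it produces. -/
def trajectoryCost (ℓ : G → ℝ) (L : Fin n → G × G → ℝ) (y : Fin (n + 1) → G) : ℝ :=
  ℓ (y (Fin.last n)) + ∑ i : Fin n, L i (y i.castSucc, (y i.castSucc)⁻¹ * y i.succ)

theorem totalCost_inv_mul (ℓ : G → ℝ) (L : Fin n → G × G → ℝ) (y : Fin (n + 1) → G) :
    totalCost (fun _ x w => x * w) ℓ L (y 0) (fun i => (y i.castSucc)⁻¹ * y i.succ) =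
      trajectoryCost ℓ L y := by
  rw [totalCost, stateSeq_inv_mul]
  rfl

/-- An interior state is the endpoint of step `j` and the starting point of step `i = j + 1`; all
other terms cancel in the difference. -/
theorem trajectoryCost_update_castSucc_sub (ℓ : G → ℝ) (L : Fin n → G × G → ℝ)
    (y : Fin (n + 1) → G) {i j : Fin n} (hij : j.succ = i.castSucc) (x x' : G) :
    trajectoryCost ℓ L (Function.update y i.castSucc x) -
        trajectoryCost ℓ L (Function.update y i.castSucc x') =
      (L j (y j.castSucc, (y j.castSucc)⁻¹ * x) + L i (x, x⁻¹ * y i.succ)) -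
        (L j (y j.castSucc, (y j.castSucc)⁻¹ * x') + L i (x', x'⁻¹ * y i.succ)) := by
  have hval : (j : ℕ) + 1 = i := by simpa [Fin.ext_iff] using hij
  have hji : j ≠ i := by
    rintro rfl
    omega
  have hlast : Fin.last n ≠ i.castSucc := (Fin.castSucc_lt_last i).ne'
  have hj : j.castSucc ≠ i.castSucc := fun h => hji (Fin.castSucc_injective n h)
  have hi : i.succ ≠ i.castSucc := (Fin.castSucc_lt_succ).ne'
  have hother : ∀ m : Fin n, m ≠ j → m ≠ i →
      m.castSucc ≠ i.castSucc ∧ m.succ ≠ i.castSucc := by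
    intro m h1 h2
    refine ⟨fun h => h2 (Fin.castSucc_injective n h), fun h => h1 ?_⟩
    rw [← hij] at h
    exact Fin.succ_injective n h
  simp only [trajectoryCost, Function.update_of_ne hlast, add_sub_add_left_eq_sub]
  rw [← Finset.sum_sub_distrib, Finset.sum_eq_add j i hji]
  · rw [hij]
    simp only [Function.update_of_ne hj, Function.update_of_ne hi, Function.update_self]
    ring
  · intro m _ hm
    obtain ⟨h1, h2⟩ := hother m hm.1 hm.2
    simp only [Function.update_of_ne h1, Function.update_of_ne h2, sub_self]
  · simp
  · simp

theorem trajectoryCost_update_last_sub (ℓ : G → ℝ) (L : Fin n → G × G → ℝ)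
    (y : Fin (n + 1) → G) {j : Fin n} (hj : j.succ = Fin.last n) (x x' : G) :
    trajectoryCost ℓ L (Function.update y (Fin.last n) x) -
        trajectoryCost ℓ L (Function.update y (Fin.last n) x') =
      (ℓ x + L j (y j.castSucc, (y j.castSucc)⁻¹ * x)) -
        (ℓ x' + L j (y j.castSucc, (y j.castSucc)⁻¹ * x')) := by
  have hc : ∀ m : Fin n, m.castSucc ≠ Fin.last n := fun m => (Fin.castSucc_lt_last m).ne
  have hother : ∀ m : Fin n, m ≠ j → m.succ ≠ Fin.last n := by
    intro m h1 h
    rw [← hj] at h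
    exact h1 (Fin.succ_injective n h)
  simp only [trajectoryCost, Function.update_self, add_sub_add_comm]
  rw [← Finset.sum_sub_distrib, Finset.sum_eq_single j]
  · rw [hj]
    simp only [Function.update_of_ne (hc _), Function.update_self]
  · intro m _ hm
    simp only [Function.update_of_ne (hc _), Function.update_of_ne (hother m hm), sub_self]
  · simp

end Trajectories

/-! ### Variation of one state and the conclusion. -/

section Main

variable {E : Type*} [NormedAddCommGroup E] [NormedSpace ℝ E]
  {H : Type*} [TopologicalSpace H] {I : ModelWithCorners ℝ E H}
  {M : Type*} [TopologicalSpace M] [ChartedSpace H M]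

theorem DiniNonnegAt.congr_sub {f f' : M → ℝ} {q : M} (hf : DiniNonnegAt I f q)
    (h : ∀ x, f x - f q = f' x - f' q) : DiniNonnegAt I f' q := by
  intro c hc hc0
  simpa only [h] using hf c hc hc0

/-- A smooth motion of one state induces a smooth curve of controls; `k ≠ 0` keeps the initial state
fixed. -/
theorem IsCritical.diniNonnegAt_trajectoryCost
    {G : Type*} [TopologicalSpace G] [ChartedSpace H G] [Group G] [I.Boundaryless]
    [LieGroup I ∞ G] [IsManifold I 1 G] {n : ℕ} {ℓ : G → ℝ} {L : Fin n → G × G → ℝ}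
    {y : Fin (n + 1) → G}
    (hu : IsCritical (ModelWithCorners.pi fun _ : Fin n => I) (univ : Set (Fin n → G))
      (totalCost (fun _ x w => x * w) ℓ L (y 0)) fun i => (y i.castSucc)⁻¹ * y i.succ)
    {k : Fin (n + 1)} (hk : k ≠ 0) :
    DiniNonnegAt I (fun x => trajectoryCost ℓ L (Function.update y k x)) (y k) := by
  intro c hc hc0
  have hsmooth : ∀ m, ContMDiff 𝓘(ℝ, ℝ) I ∞ fun t => Function.update y k (c t) m := by
    intro m
    rcases eq_or_ne m k with rfl | hm
    · simpa using hc
    · simpa [Function.update_of_ne hm] using contMDiff_const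
  have hcost : ∀ t, totalCost (fun _ x w => x * w) ℓ L (y 0)
      (fun i => (Function.update y k (c t) i.castSucc)⁻¹ * Function.update y k (c t) i.succ) =
        trajectoryCost ℓ L (Function.update y k (c t)) := by
    intro t
    rw [← totalCost_inv_mul, Function.update_of_ne hk.symm]
  have hcost0 := hcost 0
  rw [hc0] at hcost0
  have h := IsCritical.zero_le_liminf (J := totalCost (fun _ x w => x * w) ℓ L (y 0))
    (I := ModelWithCorners.pi fun _ : Fin n => I)
    (c := fun t i => (Function.update y k (c t) i.castSucc)⁻¹ *
      Function.update y k (c t) i.succ) (by simpa [hc0] using hu)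
    (contMDiff_pi fun i => (hsmooth _).inv.mul (hsmooth _))
  simpa only [hcost, hc0, hcost0] using h

end Main

theorem mainTheorem10
    {E : Type*} [NormedAddCommGroup E] [NormedSpace ℝ E] [FiniteDimensional ℝ E]
    {G : Type*} [TopologicalSpace G] [T2Space G] [ChartedSpace E G] [Group G]
    [LieGroup 𝓘(ℝ, E) ∞ G]
    (n : ℕ) (hn : 0 < n)
    (ℓ : G → ℝ) (hℓ : LocallyLipschitzMfd 𝓘(ℝ, E) ℓ)
    (L : Fin n → G × G → ℝ)
    (hL : ∀ i, ContMDiff (𝓘(ℝ, E).prod 𝓘(ℝ, E)) 𝓘(ℝ, ℝ) 1 (L i))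
    (g₀ : G) (u : Fin n → G) (g : Fin (n + 1) → G)
    (hg : g = stateSeq (fun _ x w => x * w) g₀ u)
    (hu : IsCritical (ModelWithCorners.pi fun _ : Fin n => 𝓘(ℝ, E))
      (Set.univ : Set (Fin n → G)) (totalCost (fun _ x w => x * w) ℓ L g₀) u)
    (p : ℕ → LieDual 𝓘(ℝ, E) G)
    (hp : ∀ i : Fin n, p (i + 1) =
      leftDifferential 𝓘(ℝ, E) (fun w => L i (g i.castSucc, w)) (u i)) :
    (∀ i : Fin n, 1 ≤ (i : ℕ) → p (i + 1) =
      lieAdDual 𝓘(ℝ, E) (u i) (p i) + lieAdDual 𝓘(ℝ, E) (u i)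
        (leftDifferential 𝓘(ℝ, E) (fun x => L i (x, u i)) (g i.castSucc))) ∧
    -p n ∈ toLieDual 𝓘(ℝ, E) (g (Fin.last n)) ''
      limitingSubdiff 𝓘(ℝ, E) (fun x => (ℓ x : EReal)) (g (Fin.last n)) := by
  have hui : ∀ i, u i = (g i.castSucc)⁻¹ * g i.succ := by
    intro i
    rw [hg]
    exact control_eq_inv_mul g₀ u i
  have hg0 : g 0 = g₀ := by rw [hg]; rfl
  have hu' : IsCritical (ModelWithCorners.pi fun _ : Fin n => 𝓘(ℝ, E))
      (Set.univ : Set (Fin n → G)) (totalCost (fun _ x w => x * w) ℓ L (g 0))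
      fun i => (g i.castSucc)⁻¹ * g i.succ := by
    rw [hg0]
    convert hu using 2
    exact (hui _).symm
  have hLw : ∀ (i : Fin n) (a : G), ContMDiff 𝓘(ℝ, E) 𝓘(ℝ, ℝ) 1 fun w => L i (a, w) :=
    fun i a => (hL i).comp (contMDiff_const.prodMk contMDiff_id)
  have hLs : ∀ (i : Fin n) (a : G), ContMDiff 𝓘(ℝ, E) 𝓘(ℝ, ℝ) 1 fun x => L i (a, a⁻¹ * x) :=
    fun i a => (hLw i a).comp
      ((contMDiff_mul_left (I := 𝓘(ℝ, E)) (n := ∞) (a := a⁻¹)).of_le (by simp))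
  -- By left invariance, differentiating in the control equals differentiating in the state it leads
  -- to.
  have hpj : ∀ j : Fin n, p (j + 1) = leftDifferential 𝓘(ℝ, E)
      (fun x => L j (g j.castSucc, (g j.castSucc)⁻¹ * x)) (g j.succ) := by
    intro j
    rw [hp j, leftDifferential_comp_mul_left (hLw j (g j.castSucc)), hui j]
  refine ⟨fun i hi => ?_, ?_⟩
  · obtain ⟨j, hj⟩ : ∃ j : Fin n, j.succ = i.castSucc :=
      ⟨⟨i - 1, by omega⟩, Fin.ext (by simp; omega)⟩
    have hji : (j : ℕ) + 1 = i := by simpa [Fin.ext_iff] using hj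
    have hLi : ContMDiff 𝓘(ℝ, E) 𝓘(ℝ, ℝ) 1 fun x => L i (x, x⁻¹ * g i.succ) :=
      (hL i).comp ((contMDiff_id.prodMk
        ((contMDiff_id.inv).mul (contMDiff_const (n := ∞)))).of_le (by simp))
    have hdini := (hu'.diniNonnegAt_trajectoryCost (k := i.castSucc)
      (by rw [← hj]; exact Fin.succ_ne_zero j)).congr_sub
      (fun x => trajectoryCost_update_castSucc_sub ℓ L g hj x (g i.castSucc))
    have hzero := hdini.mfderiv_eq_zero
      (((hLs j (g j.castSucc)).add hLi).mdifferentiable (by simp))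
    have hleft : leftDifferential 𝓘(ℝ, E)
        (fun x => L j (g j.castSucc, (g j.castSucc)⁻¹ * x) + L i (x, x⁻¹ * g i.succ))
        (g i.castSucc) = 0 := by
      rw [leftDifferential, hzero]
      exact ContinuousLinearMap.zero_comp _
    rw [leftDifferential_add ((hLs j (g j.castSucc)).mdifferentiable (by simp) _)
      (hLi.mdifferentiable (by simp) _), ← hj, ← hpj j, hji] at hleft
    -- Applying `Ad^*` to the stationarity condition turns its outgoing term into the state
    -- differential minus `p (i + 1)`.
    have had := lieAdDual_leftDifferential_pair (hL i) (g i.castSucc) (g i.succ)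
    rw [← hui i, ← hp i] at had
    rw [hj] at hleft
    have hsum : lieAdDual 𝓘(ℝ, E) (u i) (p i) + lieAdDual 𝓘(ℝ, E) (u i) (leftDifferential 𝓘(ℝ, E)
        (fun x => L i (x, x⁻¹ * g i.succ)) (g i.castSucc)) = 0 := by
      have := congrArg (lieAdDual 𝓘(ℝ, E) (u i)) hleft
      simpa [lieAdDual, ContinuousLinearMap.add_comp] using this
    rw [had, ← add_sub_assoc] at hsum
    exact (sub_eq_zero.1 hsum).symm
  · obtain ⟨j, hj⟩ : ∃ j : Fin n, j.succ = Fin.last n :=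
      ⟨⟨n - 1, by omega⟩, Fin.ext (by simp; omega)⟩
    have hjn : (j : ℕ) + 1 = n := by simpa [Fin.ext_iff] using hj
    have hdini := (hu'.diniNonnegAt_trajectoryCost (k := Fin.last n)
      (by rw [← hj]; exact Fin.succ_ne_zero j)).congr_sub
      (fun x => trajectoryCost_update_last_sub ℓ L g hj x (g (Fin.last n)))
    refine ⟨_, hdini.neg_mfderiv_mem_limitingSubdiff hℓ (hLs j (g j.castSucc)), ?_⟩
    have h := hpj j
    rw [hjn, hj] at h
    rw [h]
    exact ContinuousLinearMap.neg_comp _ _
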